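/- Write $q=e^{2\pi i\tau}$ and $D=\frac{1}{2\pi i}\frac{d}{d\tau}=q\frac{d}{dq}$ for $\tau$ in the upper half-plane $\mathbb H$. Let $E_2=1-24\sum_{n\ge1}\big(\sum_{d\mid n}d\big)q^n$, let $E_4,E_6$ be the normalized Eisenstein series (constant term $1$) of weights $4$ and $6$ for $\mathrm{SL}_2(\mathbb Z)$, let $\Delta=(E_4^3-E_6^2)/1728$ and $j=E_4^3/\Delta$. A weakly holomorphic modular form of weight $k$ for $\mathrm{SL}_2(\mathbb Z)$ is a holomorphic function $f$ on $\mathbb H$ with $f\big(\frac{a\tau+b}{c\tau+d}\big)=(c\tau+d)^kf(\tau)$ for all $\begin{pmatrix}a&b\\c&d\end{pmatrix}\in\mathrm{SL}_2(\mathbb Z)$, whose Fourier expansion $f=\sum_{n\in\mathbb Z}a_f(n)q^n$ has only finitely many nonzero terms with $n<0$. For such $f$ put $\vartheta_k(f)=D(f)-\frac{k}{12}E_2f$. Let $$\mathcal F=\{\tau\in\mathbb H:|\tau|\ge1,\ -\tfrac12\le\operatorname{Re}\tau\le0\}\cup\{\tau\in\mathbb H:|\tau|>1,\ 0<\operatorname{Re}\tau<\tfrac12\},$$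 $$\mathcal A=\{\tau\in\mathcal F:|\tau|=1,\ -\tfrac12\le\operatorname{Re}\tau\le0\}.$$ **Theorem 6.1.** Let $k$ be an even integer and let $f$ be a nonzero weakly holomorphic modular form of weight $k$ for $\mathrm{SL}_2(\mathbb Z)$ with real Fourier coefficients. Assume that $f$ has at least one zero in $\mathbb H$ and that all the zeros of $f$ in $\mathcal F$ lie on $\mathcal A$. Then there is a unique polynomial $P_{\vartheta_k(f)}\in\mathbb C[X]$ such that $$\vartheta_k(f)(\tau)=E_4(\tau)^{\varepsilon'}E_6(\tau)^{\delta'}\Delta(\tau)^{m'}P_{\vartheta_k(f)}(j(\tau))\qquad(\tau\in\mathbb H),$$ where $(\varepsilon',\delta',m')\in\{0,1,2\}\times\{0,1\}\times\mathbb Z$ is the triple with $k+2=4\varepsilon'+6\delta'+12m'$. This polynomial has real coefficients, and all of its complex roots lie in the closed interval $[0,1728]$. -/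

import Mathlib

open scoped UpperHalfPlane ModularForm MatrixGroups Manifold

noncomputable section

namespace SerreZeros

/-- `f` has the Fourier expansion `f τ = ∑ n : ℤ, a n * q ^ n` with `q = exp (2 π i τ)`. Such
coefficients are determined by `f`. -/
def HasFourierExpansion (f : ℍ → ℂ) (a : ℤ → ℂ) : Prop :=
  ∀ τ : ℍ, HasSum (fun n : ℤ ↦ a n * Complex.exp (2 * Real.pi * Complex.I * n * (τ : ℂ))) (f τ)

/-- Weakly holomorphic modular forms of weight `k` for `SL(2, ℤ)`: holomorphic functions on the
upper half-plane which transform like modular forms of weight `k` and whose Fourier expansion has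
only finitely many terms with negative exponent. -/
structure IsWeaklyHolomorphic (k : ℤ) (f : ℍ → ℂ) : Prop where
  holo : MDiff f
  transform : ∀ (γ : SL(2, ℤ)) (τ : ℍ), f (γ • τ) = UpperHalfPlane.denom γ τ ^ k * f τ
  fourier : ∃ (n₀ : ℤ) (a : ℤ → ℂ), (∀ n < n₀, a n = 0) ∧ HasFourierExpansion f a

/-- All Fourier coefficients of `f` are real. -/
def HasRealFourierCoefficients (f : ℍ → ℂ) : Prop :=
  ∃ a : ℤ → ℝ, HasFourierExpansion f (fun n ↦ (a n : ℂ))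

/-- The standard fundamental domain of `SL(2, ℤ)`, including the left half of its boundary. -/
def fundamentalDomain : Set ℍ :=
  {τ | 1 ≤ ‖(τ : ℂ)‖ ∧ -(1 / 2) ≤ τ.re ∧ τ.re ≤ 0} ∪
    {τ | 1 < ‖(τ : ℂ)‖ ∧ 0 < τ.re ∧ τ.re < 1 / 2}

/-- The lower boundary of the standard fundamental domain. -/
def lowerArc : Set ℍ :=
  {τ | τ ∈ fundamentalDomain ∧ ‖(τ : ℂ)‖ = 1 ∧ -(1 / 2) ≤ τ.re ∧ τ.re ≤ 0}

/-- The modular `j`-invariant `E₄ ^ 3 / Δ`. Here `Δ = (E₄ ^ 3 - E₆ ^ 2) / 1728`, by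
`ModularForm.discriminant_eq_E₄_cube_sub_E₆_sq`. -/
def jInv (τ : ℍ) : ℂ :=
  ModularForm.E₄ τ ^ 3 / ModularForm.discriminant τ

/-- `P` is a polynomial with `g = E₄ ^ ε * E₆ ^ δ * Δ ^ m * P(j)`, where `ε ∈ {0, 1, 2}`,
`δ ∈ {0, 1}` and `m ∈ ℤ` satisfy `4 ε + 6 δ + 12 m = k`. (This equation determines
`ε`, `δ` and `m`.) -/
def IsAssociatedPolynomial (k : ℤ) (g : ℍ → ℂ) (P : Polynomial ℂ) : Prop :=
  ∃ (ε δ : ℕ) (m : ℤ), ε ≤ 2 ∧ δ ≤ 1 ∧ k = 4 * ε + 6 * δ + 12 * m ∧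
    ∀ τ : ℍ, g τ = ModularForm.E₄ τ ^ ε * ModularForm.E₆ τ ^ δ *
      ModularForm.discriminant τ ^ m * P.eval (jInv τ)

end SerreZeros

end

open scoped UpperHalfPlane ModularForm MatrixGroups Manifold

noncomputable section

namespace SerreZeros

open UpperHalfPlane hiding I
open Filter hiding pi
open ModularForm EisensteinSeries Derivative Function Topology ComplexConjugate
open Complex (I)
open Real (pi)

/-! Write f = E₄^ε E₆^δ Δ^m P(j). The Serre derivative ϑ is a derivation with ϑE₄ = -E₆/3, ϑE₆ =
-E₄²/2, ϑΔ = 0 and Dj = -E₄²E₆/Δ. As E₄³ = jΔ and E₆² = (j - 1728)Δ, this gives ϑf = -f · (E₄²E₆/Δ)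
· R(j) with R = (ε/3)/X + (δ/2)/(X - 1728) + P'/P. Hence the polynomial of ϑf divides the numerator
of R (`exists_isAssociatedPolynomial_serreDerivative`).

Every root of P is a value of j at a zero of f, which can be moved to the arc, and j maps the arc
into [0, 1728] (`jInv_mem_Icc_of_mem_arc`). So R is a nonnegative combination of terms 1/(X - r)
with r in [0, 1728], and the Gauss–Lucas argument (`isRoot_logDerivNum`) keeps the zeros of its
numerator there. The zero of f ensures that R is not identically 0. -/

/-! ### Limits at i∞. -/

/-- A holomorphic function on `ℍ` that is invariant under `SL(2, ℤ)` in weight `k` and bounded at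
`i∞`, as a modular form. -/
def modularFormOfInvariant {k : ℤ} (g : ℍ → ℂ) (hg : MDiff g)
    (hs : ∀ γ : SL(2, ℤ), g ∣[k] γ = g) (hb : IsBoundedAtImInfty g) : ModularForm 𝒮ℒ k where
  toFun := g
  slash_action_eq' A hA := by
    obtain ⟨A, rfl⟩ := hA
    exact hs A
  holo' := hg
  bdd_at_cusps' {c} hc := by
    rw [Subgroup.IsArithmetic.isCusp_iff_isCusp_SL2Z] at hc
    rw [OnePoint.isBoundedAt_iff_forall_SL2Z hc]
    intro γ _
    rwa [hs]

@[simp]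
lemma modularFormOfInvariant_apply {k : ℤ} (g : ℍ → ℂ) (hg : MDiff g)
    (hs : ∀ γ : SL(2, ℤ), g ∣[k] γ = g) (hb : IsBoundedAtImInfty g) (τ : ℍ) :
    modularFormOfInvariant g hg hs hb τ = g τ := rfl

lemma slash_eq {k : ℤ} (g : ModularForm 𝒮ℒ k) (γ : SL(2, ℤ)) : ⇑g ∣[k] γ = g :=
  SlashInvariantFormClass.slash_action_eq g _ ⟨γ, rfl⟩

lemma tendsto_valueAtInfty {k : ℤ} (g : ModularForm 𝒮ℒ k) :
    Tendsto g atImInfty (𝓝 ((qExpansion 1 g).coeff 0)) := by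
  have han := ModularFormClass.analyticAt_cuspFunction_zero g one_pos one_mem_strictPeriods_SL
  have h1 := han.continuousAt.tendsto.comp (qParam_tendsto_atImInfty one_pos)
  rw [qExpansion_coeff]
  simp only [Nat.factorial_zero, Nat.cast_one, inv_one, iteratedDeriv_zero, one_mul]
  refine h1.congr fun τ ↦ ?_
  exact SlashInvariantFormClass.eq_cuspFunction g τ one_mem_strictPeriods_SL one_ne_zero

/-- The derivative of a modular form vanishes at `i∞`. -/
lemma tendsto_normalizedDeriv {k : ℤ} (g : ModularForm 𝒮ℒ k) :
    Tendsto (normalizedDerivOfComplex g) atImInfty (𝓝 0) := by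
  have han := ModularFormClass.analyticAt_cuspFunction_zero g one_pos one_mem_strictPeriods_SL
  have hq := qParam_tendsto_atImInfty one_pos
  -- With F the cusp function, Dg = q F'(q), and q tends to 0.
  have h1 := hq.mul (han.deriv.continuousAt.tendsto.comp hq)
  rw [zero_mul] at h1
  refine h1.congr fun τ ↦ ?_
  have hF : DifferentiableAt ℂ (cuspFunction 1 g) (Periodic.qParam 1 τ) :=
    ModularFormClass.differentiableAt_cuspFunction g one_pos one_mem_strictPeriods_SL
      (Periodic.norm_qParam_lt_one one_pos τ.im_pos)
  have hE : HasDerivAt (fun w : ℂ ↦ Periodic.qParam 1 w)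
      (2 * pi * I * Periodic.qParam 1 τ) (τ : ℂ) := by
    have := ((hasDerivAt_id (τ : ℂ)).const_mul (2 * pi * I)).cexp
    simp only [Periodic.qParam, Complex.ofReal_one, div_one]
    convert! this using 1
    simp [mul_comm]
  have hc := hF.hasDerivAt.comp (τ : ℂ) hE
  have heq : (g ∘ ofComplex) =ᶠ[𝓝 (τ : ℂ)] cuspFunction 1 g ∘ fun w ↦ Periodic.qParam 1 w := by
    filter_upwards [isOpen_upperHalfPlaneSet.mem_nhds τ.im_pos] with w hw
    have := SlashInvariantFormClass.eq_cuspFunction g ⟨w, hw⟩ one_mem_strictPeriods_SL one_ne_zero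
    simp only [comp_apply, ofComplex_apply_of_im_pos hw]
    exact this.symm
  rw [normalizedDerivOfComplex, (hc.congr_of_eventuallyEq heq).deriv]
  have : (2 * pi * I : ℂ) ≠ 0 := Complex.two_pi_I_ne_zero
  simp only [comp_apply]
  field_simp

/-- `E2` is not modular, so the analyticity of its cusp function is derived from periodicity and
boundedness. -/
lemma tendsto_E2 : Tendsto E2 atImInfty (𝓝 1) := by
  have hs (τ : ℍ) : HasSum
      (fun m : ℕ ↦ (if m = 0 then 1 else -24 * ArithmeticFunction.sigma 1 m : ℂ) •
        Periodic.qParam 1 τ ^ m) (E2 τ) := by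
    simpa only [Periodic.qParam, Complex.ofReal_one, div_one] using hasSum_qExpansion_E2 (z := τ)
  have hper : Periodic (E2 ∘ ofComplex) (1 : ℝ) := by
    intro w
    by_cases! hw : 0 < Complex.im w
    · have hw' : 0 < Complex.im (w + (1 : ℝ)) := by simpa using hw
      have h1 := hs ⟨w, hw⟩
      have h2 := hs ⟨w + (1 : ℝ), hw'⟩
      have hq : Periodic.qParam 1 (w + (1 : ℝ)) = Periodic.qParam 1 w :=
        by
        simp [Periodic.qParam, mul_add, Complex.exp_add, Complex.exp_two_pi_mul_I]
      simp only [comp_apply, ofComplex_apply_of_im_pos hw, ofComplex_apply_of_im_pos hw']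
      simp only [hq] at h2
      exact h2.unique h1
    · have hw' : Complex.im (w + (1 : ℝ)) ≤ 0 := by simpa using hw
      simp only [comp_apply, ofComplex_apply_of_im_nonpos hw, ofComplex_apply_of_im_nonpos hw']
  have han : AnalyticAt ℂ (cuspFunction 1 E2) 0 :=
    analyticAt_cuspFunction_zero one_pos hper E2_mdifferentiable isBoundedAtImInfty_E2
  have h0 := (hasFPowerSeriesOnBall_cuspFunction one_pos han hs).coeff_zero ![]
  simp [FormalMultilinearSeries.ofScalars] at h0
  have h1 := han.continuousAt.tendsto.comp (qParam_tendsto_atImInfty one_pos)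
  rw [← h0] at h1
  exact h1.congr fun τ ↦ eq_cuspFunction τ one_ne_zero hper

lemma tendsto_serreDerivative {k : ℤ} (g : ModularForm 𝒮ℒ k) :
    Tendsto (serreDerivative k g) atImInfty (𝓝 (-k / 12 * (qExpansion 1 g).coeff 0)) := by
  have := (tendsto_normalizedDeriv g).sub
    (((tendsto_E2.const_mul ((k : ℂ) * 12⁻¹))).mul (tendsto_valueAtInfty g))
  refine this.congr' (Eventually.of_forall fun τ ↦ ?_) |>.trans (le_of_eq ?_)
  · simp
  · congr 1
    ring

/-! ### Ramanujan's identities and the derivative of j. -/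

/-- The Serre derivative of a modular form of level one. -/
def serreModularForm {k : ℤ} (g : ModularForm 𝒮ℒ k) : ModularForm 𝒮ℒ (k + 2) :=
  modularFormOfInvariant (serreDerivative k g)
    (serreDerivative_mdifferentiable _ g.holo')
    (fun γ ↦ serreDerivative_slash_invariant g.holo' (slash_eq g γ))
    ((tendsto_serreDerivative g).isBigO_one ℝ)

@[simp]
lemma serreModularForm_apply {k : ℤ} (g : ModularForm 𝒮ℒ k) (τ : ℍ) :
    serreModularForm g τ = serreDerivative k g τ := rfl

lemma exists_smul_eq {k : ℤ} {g₀ : ModularForm 𝒮ℒ k} (hr : Module.rank ℂ (ModularForm 𝒮ℒ k) = 1)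
    (h0 : g₀ ≠ 0) (g : ModularForm 𝒮ℒ k) : ∃ c : ℂ, ∀ τ, g τ = c * g₀ τ := by
  obtain ⟨c, hc⟩ := (finrank_eq_one_iff_of_nonzero' g₀ h0).mp
    (Module.rank_eq_one_iff_finrank_eq_one.mp hr) g
  exact ⟨c, fun τ ↦ by rw [← hc]; rfl⟩

lemma tendsto_E₄ : Tendsto E₄ atImInfty (𝓝 1) := by
  simpa [E_qExpansion_coeff _ (show Even 4 from ⟨2, rfl⟩) 0] using tendsto_valueAtInfty E₄

lemma tendsto_E₆ : Tendsto E₆ atImInfty (𝓝 1) := by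
  simpa [E_qExpansion_coeff _ (show Even 6 from ⟨3, rfl⟩) 0] using tendsto_valueAtInfty E₆

/-- The space of weight 6 is a line, so only the constant has to be found, by comparing limits at
i∞. The same works for `E₆`, with weight 8 spanned by E₄². -/
lemma serreDerivative_E₄ (τ : ℍ) : serreDerivative 4 E₄ τ = -(1 / 3) * E₆ τ := by
  obtain ⟨c, hc⟩ := exists_smul_eq (g₀ := E₆) levelOne_weight_six_rank_one (E_ne_zero _ ⟨3, rfl⟩)
    (serreModularForm E₄)
  have h1 := tendsto_serreDerivative E₄
  have h2 := (tendsto_E₆.const_mul c).congr fun τ ↦ (hc τ).symm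
  have h3 := tendsto_nhds_unique h1 h2
  rw [E_qExpansion_coeff_zero _ ⟨2, rfl⟩] at h3
  have hc' : c = -(1 / 3) := by
    push_cast at h3
    linear_combination -h3
  have := hc τ
  rw [hc', serreModularForm_apply] at this
  exact_mod_cast this

lemma serreDerivative_E₆ (τ : ℍ) : serreDerivative 6 E₆ τ = -(1 / 2) * E₄ τ ^ 2 := by
  have hr : Module.rank ℂ (ModularForm 𝒮ℒ (4 + 4)) = 1 := by
    simpa [Nat.ModEq] using dimension_level_one 8 ⟨4, rfl⟩
  have h44 (τ : ℍ) : (E₄.mul E₄) τ = E₄ τ ^ 2 := by rw [sq]; rfl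
  have ht : Tendsto (E₄.mul E₄) atImInfty (𝓝 1) := by
    have := tendsto_E₄.pow 2
    rw [one_pow] at this
    exact this.congr fun τ ↦ (h44 τ).symm
  have hne : E₄.mul E₄ ≠ 0 := by
    intro h
    rw [h] at ht
    exact zero_ne_one (tendsto_nhds_unique tendsto_const_nhds ht)
  obtain ⟨c, hc⟩ := exists_smul_eq hr hne (serreModularForm E₆)
  have h1 := tendsto_serreDerivative E₆
  have h2 := (ht.const_mul c).congr fun τ ↦ (hc τ).symm
  have h3 := tendsto_nhds_unique h1 h2
  rw [E_qExpansion_coeff_zero _ ⟨3, rfl⟩] at h3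
  have hc' : c = -(1 / 2) := by
    push_cast at h3
    linear_combination -h3
  have := hc τ
  rw [hc', h44, serreModularForm_apply] at this
  exact_mod_cast this

/-- Differentiability of a holomorphic function on `ℍ`, in terms of `D`. -/
lemma hasDerivAt_comp_ofComplex {g : ℍ → ℂ} (hg : MDiff g) (τ : ℍ) :
    HasDerivAt (g ∘ ofComplex) (2 * pi * I * normalizedDerivOfComplex g τ) (τ : ℂ) := by
  have h := (mdifferentiableAt_iff.mp (hg τ)).hasDerivAt
  convert! h using 1
  rw [normalizedDerivOfComplex, mul_inv_cancel_left₀ Complex.two_pi_I_ne_zero]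

/-- Ramanujan's identity for `E₄`. -/
lemma hasDerivAt_E₄ (τ : ℍ) : HasDerivAt (E₄ ∘ ofComplex)
    (2 * pi * I * ((E2 τ * E₄ τ - E₆ τ) / 3)) (τ : ℂ) := by
  convert! hasDerivAt_comp_ofComplex E₄.holo' τ using 2
  have := serreDerivative_E₄ τ
  rw [serreDerivative_apply] at this
  linear_combination -this

/-- Ramanujan's identity for `E₆`. -/
lemma hasDerivAt_E₆ (τ : ℍ) : HasDerivAt (E₆ ∘ ofComplex)
    (2 * pi * I * ((E2 τ * E₆ τ - E₄ τ ^ 2) / 2)) (τ : ℂ) := by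
  convert! hasDerivAt_comp_ofComplex E₆.holo' τ using 2
  have := serreDerivative_E₆ τ
  rw [serreDerivative_apply] at this
  linear_combination -this

/-- The two E₄²E₆ terms cancel, so ϑΔ = 0 in weight 12. -/
lemma hasDerivAt_discriminant (τ : ℍ) : HasDerivAt (discriminant ∘ ofComplex)
    (2 * pi * I * (E2 τ * discriminant τ)) (τ : ℂ) := by
  have h := (((hasDerivAt_E₄ τ).pow 3).sub ((hasDerivAt_E₆ τ).pow 2)).div_const 1728
  have he : discriminant ∘ ofComplex =
      fun w ↦ (((E₄ ∘ ofComplex) ^ 3 - (E₆ ∘ ofComplex) ^ 2 : ℂ → ℂ) w) / 1728 := by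
    ext w
    simp [discriminant_eq_E₄_cube_sub_E₆_sq]
  rw [he]
  convert! h using 1
  simp only [comp_apply, ofComplex_apply, discriminant_eq_E₄_cube_sub_E₆_sq]
  ring

lemma E₄_pow_three (τ : ℍ) : E₄ τ ^ 3 = jInv τ * discriminant τ := by
  rw [jInv, div_mul_cancel₀ _ (discriminant_ne_zero τ)]

lemma E₆_pow_two (τ : ℍ) : E₆ τ ^ 2 = (jInv τ - 1728) * discriminant τ := by
  have h := discriminant_eq_E₄_cube_sub_E₆_sq τ
  linear_combination 1728 * h + E₄_pow_three τ

lemma hasDerivAt_jInv (τ : ℍ) : HasDerivAt (jInv ∘ ofComplex)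
    (2 * pi * I * (-(E₄ τ ^ 2 * E₆ τ / discriminant τ))) (τ : ℂ) := by
  have hΔ := discriminant_ne_zero τ
  have h := ((hasDerivAt_E₄ τ).pow 3).div (hasDerivAt_discriminant τ)
    (by simpa using hΔ)
  convert! h using 1
  simp only [comp_apply, ofComplex_apply, Pi.pow_apply]
  field_simp
  ring

/-! ### Symmetries under `J` and SL(2, ℤ), and surjectivity of j. -/

/-- `J` sends τ to minus its conjugate, hence q to its conjugate; real coefficients thus become a
reflection symmetry. -/
lemma exp_J_smul (τ : ℍ) (n : ℤ) :
    Complex.exp (2 * pi * I * n * (J • τ : ℍ)) = conj (Complex.exp (2 * pi * I * n * (τ : ℂ))) := by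
  rw [← Complex.exp_conj, coe_J_smul]
  simp [Complex.conj_ofNat]

lemma HasRealFourierCoefficients.J_smul {g : ℍ → ℂ} (hg : HasRealFourierCoefficients g) (τ : ℍ) :
    g (J • τ) = conj (g τ) := by
  obtain ⟨a, ha⟩ := hg
  have h1 := (Complex.hasSum_conj'.mpr (ha τ))
  refine (ha (J • τ)).unique ?_
  simpa only [map_mul, Complex.conj_ofReal, exp_J_smul] using h1

lemma J_smul_of_real_coeff {k : ℤ} (g : ModularForm 𝒮ℒ k)
    (hg : ∀ n, conj ((qExpansion 1 g).coeff n) = (qExpansion 1 g).coeff n) (τ : ℍ) :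
    g (J • τ) = conj (g τ) := by
  have hs := ModularForm.hasSum_qExpansion g one_pos one_mem_strictPeriods_SL
  have h1 := (Complex.hasSum_conj'.mpr (hs τ))
  refine (hs (J • τ)).unique ?_
  have hq : Periodic.qParam 1 (J • τ : ℍ) = conj (Periodic.qParam 1 τ) := by
    simpa [Periodic.qParam] using exp_J_smul τ 1
  simpa only [map_mul, map_pow, hg, hq] using h1

lemma E₄_J_smul (τ : ℍ) : E₄ (J • τ) = conj (E₄ τ) := by
  refine J_smul_of_real_coeff _ (fun n ↦ ?_) τ
  rw [E_qExpansion_coeff _ ⟨2, rfl⟩]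
  split_ifs <;> simp [Complex.conj_ofNat]

lemma E₆_J_smul (τ : ℍ) : E₆ (J • τ) = conj (E₆ τ) := by
  refine J_smul_of_real_coeff _ (fun n ↦ ?_) τ
  rw [E_qExpansion_coeff _ ⟨3, rfl⟩]
  split_ifs <;> simp [Complex.conj_ofNat]

lemma discriminant_J_smul (τ : ℍ) : discriminant (J • τ) = conj (discriminant τ) := by
  simp [discriminant_eq_E₄_cube_sub_E₆_sq, E₄_J_smul, E₆_J_smul, Complex.conj_ofNat]

lemma jInv_J_smul (τ : ℍ) : jInv (J • τ) = conj (jInv τ) := by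
  simp [jInv, E₄_J_smul, discriminant_J_smul]

lemma apply_smul {k : ℤ} (g : ModularForm 𝒮ℒ k) (γ : SL(2, ℤ)) (τ : ℍ) :
    g (γ • τ) = denom γ τ ^ k * g τ := by
  have h := congrFun (slash_eq g γ) τ
  rw [SL_slash_apply, zpow_neg] at h
  rw [← h, mul_comm, mul_assoc, inv_mul_cancel₀ (zpow_ne_zero _ (denom_ne_zero _ _)), mul_one]

lemma discriminant_smul (γ : SL(2, ℤ)) (τ : ℍ) :
    discriminant (γ • τ) = denom γ τ ^ 12 * discriminant τ := by
  rw [discriminant_eq_E₄_cube_sub_E₆_sq, discriminant_eq_E₄_cube_sub_E₆_sq, apply_smul, apply_smul]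
  norm_cast
  ring

lemma jInv_smul (γ : SL(2, ℤ)) (τ : ℍ) : jInv (γ • τ) = jInv τ := by
  have hd := denom_ne_zero γ τ
  rw [jInv, jInv, discriminant_smul, apply_smul]
  norm_cast
  rw [mul_pow, ← pow_mul, mul_div_mul_left _ _ (pow_ne_zero _ hd)]

lemma mdifferentiable_discriminant : MDiff discriminant :=
  CuspForm.discriminant.holo'

lemma mdifferentiable_jInv : MDiff jInv :=
  (E₄.holo'.pow 3).div mdifferentiable_discriminant discriminant_ne_zero

lemma tendsto_discriminant : Tendsto discriminant atImInfty (𝓝 0) :=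
  discriminant_isZeroAtImInfty

/-- The `j`-invariant takes every complex value. -/
lemma jInv_surjective : Surjective jInv := by
  intro z
  by_contra! hz
  -- If j omits z, this is a weight 0 form tending to 0 at i∞. Such forms are constant, so it would
  -- be 0, but a reciprocal never vanishes here.
  let g : ℍ → ℂ := fun τ ↦ (jInv τ - z)⁻¹
  have hg0 (τ : ℍ) : g τ ≠ 0 := inv_ne_zero (sub_ne_zero.mpr (hz τ))
  have hlim : Tendsto g atImInfty (𝓝 0) := by
    have h := tendsto_discriminant.div
      ((tendsto_E₄.pow 3).sub (tendsto_discriminant.const_mul z)) (by simp)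
    simp only [mul_zero, zero_div] at h
    refine h.congr fun τ ↦ ?_
    have := discriminant_ne_zero τ
    simp only [g, jInv, Pi.div_apply]
    rw [← inv_div, div_sub' this, mul_comm z]
  have hd : MDiff g := by
    have := (mdifferentiable_const (c := (1 : ℂ)) (I := modelWithCornersSelf ℂ ℂ) (M := ℍ)
      (I' := modelWithCornersSelf ℂ ℂ)).div
      (mdifferentiable_jInv.sub (mdifferentiable_const (c := z)))
      (fun τ ↦ sub_ne_zero.mpr (hz τ))
    convert! this using 1
    ext τ
    simp [g]
  let G : ModularForm 𝒮ℒ 0 := modularFormOfInvariant g hd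
    (fun γ ↦ by
      ext τ
      rw [SL_slash_apply, neg_zero, zpow_zero, mul_one]
      simp only [g, jInv_smul])
    (hlim.isBigO_one ℝ)
  obtain ⟨c, hc⟩ := ModularFormClass.levelOne_weight_zero_const G
  have hgc : g = Function.const _ c := hc
  rw [hgc] at hlim
  have hc0 : c = 0 := tendsto_nhds_unique tendsto_const_nhds hlim
  exact hg0 UpperHalfPlane.I (by rw [hgc, hc0]; rfl)

/-! ### The values of j on the arc. -/

/-- A solution `b` of `b' = c b + π a²` starting at zero, normalized by a solution `s` of
`s' = 2 c s`, moves monotonically. -/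
lemma sq_div_mem_uIcc {a b c s : ℝ → ℝ} {t₀ t₁ : ℝ}
    (hb : ∀ t ∈ Set.Icc t₀ t₁, HasDerivAt b (c t * b t + pi * a t ^ 2) t)
    (hs : ∀ t ∈ Set.Icc t₀ t₁, HasDerivAt s (2 * c t * s t) t)
    (hs0 : ∀ t ∈ Set.Icc t₀ t₁, s t ≠ 0) (hb0 : b t₀ = 0) {t : ℝ} (ht : t ∈ Set.Icc t₀ t₁) :
    b t ^ 2 / s t ∈ Set.uIcc 0 (b t₁ ^ 2 / s t₁) := by
  have ht01 : t₀ ≤ t₁ := ht.1.trans ht.2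
  have hl : t₀ ∈ Set.Icc t₀ t₁ := ⟨le_rfl, ht01⟩
  have hr : t₁ ∈ Set.Icc t₀ t₁ := ⟨ht01, le_rfl⟩
  have hcont : ContinuousOn s (Set.Icc t₀ t₁) :=
    fun x hx ↦ (hs x hx).continuousAt.continuousWithinAt
  -- σ is the constant sign of s, so that √(σ s) makes sense.
  obtain ⟨σ, hσ, hpos⟩ : ∃ σ : ℝ, σ ^ 2 = 1 ∧ ∀ x ∈ Set.Icc t₀ t₁, 0 < σ * s x := by
    rcases lt_or_gt_of_ne (hs0 _ hl) with h | h
    · refine ⟨-1, by norm_num, fun x hx ↦ ?_⟩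
      by_contra! hx'
      obtain ⟨y, hy, hy0⟩ := isPreconnected_Icc.intermediate_value hl hx hcont
        (show (0 : ℝ) ∈ Set.Icc (s t₀) (s x) from ⟨h.le, by linarith⟩)
      exact hs0 y hy hy0
    · refine ⟨1, by norm_num, fun x hx ↦ ?_⟩
      by_contra! hx'
      obtain ⟨y, hy, hy0⟩ := isPreconnected_Icc.intermediate_value hx hl hcont
        (show (0 : ℝ) ∈ Set.Icc (s x) (s t₀) from ⟨by linarith, h.le⟩)
      exact hs0 y hy hy0
  -- The terms in c cancel in the quotient, leaving a nonnegative derivative. The quotient increases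
  -- from 0, so its square increases too.
  have hd : ∀ x ∈ Set.Icc t₀ t₁, HasDerivAt (fun y ↦ b y / √(σ * s y))
      (pi * a x ^ 2 / √(σ * s x)) x := by
    intro x hx
    have hp := hpos x hx
    have hq := Real.sqrt_pos.mpr hp
    have h := (hb x hx).div (((hs x hx).const_mul σ).sqrt hp.ne') hq.ne'
    convert! h using 1
    have hsq : √(σ * s x) ^ 2 = σ * s x := Real.sq_sqrt hp.le
    rw [show σ * (2 * c x * s x) = 2 * c x * √(σ * s x) ^ 2 by rw [hsq]; ring]
    field_simp
    ring
  have hmono : MonotoneOn (fun y ↦ b y / √(σ * s y)) (Set.Icc t₀ t₁) :=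
    monotoneOn_of_hasDerivWithinAt_nonneg (convex_Icc _ _)
      (fun x hx ↦ (hd x hx).continuousAt.continuousWithinAt)
      (fun x hx ↦ (hd x (interior_subset hx)).hasDerivWithinAt)
      (fun x _ ↦ by positivity)
  have h0 := hmono hl ht ht.1
  have h1 := hmono ht hr ht.2
  simp only [hb0, zero_div] at h0
  have heq : ∀ x ∈ Set.Icc t₀ t₁, b x ^ 2 / s x = σ * (b x / √(σ * s x)) ^ 2 := by
    intro x hx
    have hσ0 : σ ≠ 0 := by rintro rfl; simp at hσ
    rw [div_pow, Real.sq_sqrt (hpos x hx).le]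
    have := hs0 x hx
    field_simp
  rw [heq t ht, heq t₁ hr, Set.mem_uIcc]
  have h2 := pow_le_pow_left₀ h0 h1 2
  have h3 := sq_nonneg (b t / √(σ * s t))
  simp only at h2
  rcases sq_eq_one_iff.mp hσ with rfl | rfl
  · left; constructor <;> linarith
  · right; constructor <;> linarith

lemma S_smul_eq_J_smul {τ : ℍ} (hτ : ‖(τ : ℂ)‖ = 1) : ModularGroup.S • τ = J • τ := by
  ext
  rw [coe_J_smul, modular_S_smul]
  simp [inv_neg, Complex.inv_eq_conj hτ]

/-- On the unit circle `S` and `J` agree, so the conjugate of g(τ) is τ^(2n) g(τ); as conj τ = τ⁻¹,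
the number τ^n g(τ) is its own conjugate. -/
lemma im_pow_mul_eq_zero {g : ℍ → ℂ} {n : ℕ} {τ : ℍ} (hτ : ‖(τ : ℂ)‖ = 1)
    (hJ : g (J • τ) = conj (g τ)) (hS : g (ModularGroup.S • τ) = (τ : ℂ) ^ (2 * n) * g τ) :
    ((τ : ℂ) ^ n * g τ).im = 0 := by
  rw [← Complex.conj_eq_iff_im, map_mul, map_pow, ← hJ, ← S_smul_eq_J_smul hτ, hS,
    ← Complex.inv_eq_conj hτ, two_mul, pow_add]
  rw [inv_pow, mul_assoc, inv_mul_cancel_left₀ (pow_ne_zero _ τ.ne_zero)]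

lemma E₄_S_smul (τ : ℍ) : E₄ (ModularGroup.S • τ) = (τ : ℂ) ^ 4 * E₄ τ := by
  rw [apply_smul, ModularGroup.denom_S]
  norm_cast

lemma E₆_S_smul (τ : ℍ) : E₆ (ModularGroup.S • τ) = (τ : ℂ) ^ 6 * E₆ τ := by
  rw [apply_smul, ModularGroup.denom_S]
  norm_cast

lemma discriminant_S_smul (τ : ℍ) :
    discriminant (ModularGroup.S • τ) = (τ : ℂ) ^ 12 * discriminant τ := by
  rw [discriminant_smul, ModularGroup.denom_S]

/-- The function `θ ↦ τ ^ n * g τ` for `τ = exp (i θ)`. -/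
def arcFun (n : ℕ) (g : ℍ → ℂ) (θ : ℝ) : ℂ :=
  Complex.exp (θ * I) ^ n * g (ofComplex (Complex.exp (θ * I)))

lemma arcFun_eq {n : ℕ} {g : ℍ → ℂ} {θ : ℝ} {τ : ℍ} (hτ : (τ : ℂ) = Complex.exp (θ * I)) :
    arcFun n g θ = (τ : ℂ) ^ n * g τ := by
  rw [arcFun, ← hτ, ofComplex_apply]

lemma hasDerivAt_arcFun {n : ℕ} {g : ℍ → ℂ} {θ : ℝ} {τ : ℍ} {d : ℂ}
    (hτ : (τ : ℂ) = Complex.exp (θ * I))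
    (hg : HasDerivAt (g ∘ ofComplex) (2 * pi * I * d) (τ : ℂ)) :
    HasDerivAt (arcFun n g) (n * I * ((τ : ℂ) ^ n * g τ) - 2 * pi * ((τ : ℂ) ^ (n + 1) * d)) θ := by
  have hI := Complex.I_sq
  have he : HasDerivAt (fun t : ℝ ↦ Complex.exp (t * I)) ((τ : ℂ) * I) θ := by
    have := ((Complex.ofRealCLM.hasDerivAt (x := θ)).mul_const I).cexp
    rw [hτ]
    simpa using this
  rw [hτ] at hg
  have h := (he.pow n).mul (hg.comp θ he)
  convert! h using 1
  simp only [Pi.pow_apply, comp_apply, ← hτ, ofComplex_apply]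
  -- The power rule involves the truncated exponent n - 1.
  rcases n with _ | n
  · simp
    linear_combination (-2 * pi * τ * d) * hI
  · simp only [Nat.add_sub_cancel]
    push_cast
    linear_combination (-2 * pi * τ ^ (n + 1) * τ * d) * hI

lemma HasDerivAt.complex_re {u : ℝ → ℂ} {u' : ℂ} {t : ℝ} (h : HasDerivAt u u' t) :
    HasDerivAt (fun x ↦ (u x).re) u'.re t := by
  simpa using! Complex.reCLM.hasFDerivAt.comp_hasDerivAt t h

lemma exists_coe_eq_exp {θ : ℝ} (h0 : 0 < θ) (h1 : θ < pi) :
    ∃ τ : ℍ, (τ : ℂ) = Complex.exp (θ * I) ∧ ‖(τ : ℂ)‖ = 1 :=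
  ⟨⟨Complex.exp (θ * I), by
    rw [Complex.exp_ofReal_mul_I_im]; exact Real.sin_pos_of_pos_of_lt_pi h0 h1⟩, rfl,
    Complex.norm_exp_ofReal_mul_I θ⟩

/-- This is the point i, fixed by `S`, where the weight 6 factor is i⁶ = -1. -/
lemma E₆_eq_zero {τ : ℍ} (h : (τ : ℂ) ^ 2 = -1) : E₆ τ = 0 := by
  have hS : ModularGroup.S • τ = τ := by
    ext
    rw [modular_S_smul]
    have := τ.ne_zero
    simp only
    rw [inv_eq_iff_eq_inv, eq_comm]
    refine inv_eq_of_mul_eq_one_left ?_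
    linear_combination -h
  have h6 := E₆_S_smul τ
  rw [hS, show (τ : ℂ) ^ 6 = ((τ : ℂ) ^ 2) ^ 3 by ring, h] at h6
  linear_combination h6 / 2

/-- Here -1/τ = τ + 1, so the transformations under `S` and `T` give τ⁴ E₄ = E₄, while τ⁴ = τ ≠ 1.
-/
lemma E₄_eq_zero {τ : ℍ} (h : (τ : ℂ) ^ 2 + τ + 1 = 0) : E₄ τ = 0 := by
  have hT := apply_smul E₄ ModularGroup.T τ
  have hST : ModularGroup.S • τ = ModularGroup.T • τ := by
    ext
    rw [modular_S_smul, modular_T_smul]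
    have := τ.ne_zero
    simp only [coe_vadd]
    refine inv_eq_of_mul_eq_one_left ?_
    push_cast
    linear_combination -h
  have hd : denom ModularGroup.T τ = 1 := by
    rw [ModularGroup.denom_apply]
    simp [ModularGroup.T]
  rw [← hST, E₄_S_smul, hd, one_zpow, one_mul] at hT
  have h4 : ((τ : ℂ) - 1) * E₄ τ = 0 := by
    linear_combination hT - (τ ^ 2 - τ) * E₄ τ * h
  refine (mul_eq_zero.mp h4).resolve_left fun h1 ↦ ?_
  have h1' : (τ : ℂ) = 1 := by linear_combination h1
  rw [h1'] at h
  norm_num at h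

/-- The `j`-invariant maps the lower arc into `[0, 1728]`. -/
lemma jInv_mem_Icc_of_mem_arc {τ : ℍ} (hτ : ‖(τ : ℂ)‖ = 1) (h1 : -(1 / 2) ≤ τ.re)
    (h2 : τ.re ≤ 0) : ∃ x ∈ Set.Icc (0 : ℝ) 1728, jInv τ = x := by
  have him {g : ℍ → ℂ} {n : ℕ} (hJ : ∀ τ, g (J • τ) = conj (g τ))
      (hS : ∀ τ : ℍ, g (ModularGroup.S • τ) = (τ : ℂ) ^ (2 * n) * g τ) {τ : ℍ}
      (hτ : ‖(τ : ℂ)‖ = 1) : ((τ : ℂ) ^ n * g τ) = (((τ : ℂ) ^ n * g τ).re : ℂ) :=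
    Complex.ext rfl (im_pow_mul_eq_zero hτ (hJ τ) (hS τ))
  have hA {τ : ℍ} (hτ : ‖(τ : ℂ)‖ = 1) := him (n := 2) E₄_J_smul E₄_S_smul hτ
  have hB {τ : ℍ} (hτ : ‖(τ : ℂ)‖ = 1) := him (n := 3) E₆_J_smul E₆_S_smul hτ
  have hC {τ : ℍ} (hτ : ‖(τ : ℂ)‖ = 1) := him (n := 6) discriminant_J_smul discriminant_S_smul hτ
  have hpos := Real.pi_pos
  have hrange {t : ℝ} (ht : t ∈ Set.Icc (pi / 2) (2 * pi / 3)) :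
      ∃ τ : ℍ, (τ : ℂ) = Complex.exp (t * I) ∧ ‖(τ : ℂ)‖ = 1 :=
    exists_coe_eq_exp (by linarith [ht.1]) (by linarith [ht.2])
  have hu {t : ℝ} {τ : ℍ} (hτt : (τ : ℂ) = Complex.exp (t * I)) (hτ : ‖(τ : ℂ)‖ = 1) :
      jInv τ - 1728 =
        (((arcFun 3 E₆ t).re ^ 2 / (arcFun 6 discriminant t).re : ℝ) : ℂ) := by
    rw [arcFun_eq hτt, arcFun_eq hτt]
    push_cast
    rw [← hB hτ, ← hC hτ, mul_pow, E₆_pow_two]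
    have := discriminant_ne_zero τ
    have := τ.ne_zero
    field_simp
  -- With a = τ²E₄, b = τ³E₆, s = τ⁶Δ, all real on the arc, Ramanujan's identities give b' = cb +
  -- πa² and s' = 2cs; `hu` identifies b²/s with j - 1728.
  let c : ℝ → ℝ := fun t ↦
    (3 * I - pi * (Complex.exp (t * I) * E2 (ofComplex (Complex.exp (t * I))))).re
  have key := fun {t : ℝ} ↦ sq_div_mem_uIcc (a := fun t ↦ (arcFun 2 E₄ t).re)
    (b := fun t ↦ (arcFun 3 E₆ t).re) (s := fun t ↦ (arcFun 6 discriminant t).re) (c := c)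
    (t₀ := pi / 2) (t₁ := 2 * pi / 3) (t := t) ?_ ?_ ?_ ?_
  rotate_left
  · intro t ht
    obtain ⟨τ, hτt, hτ⟩ := hrange ht
    convert! HasDerivAt.complex_re (hasDerivAt_arcFun (n := 3) hτt (hasDerivAt_E₆ τ)) using 1
    have h4 := hA hτ
    have h6 := hB hτ
    simp only [c, arcFun_eq hτt, ← hτt, ofComplex_apply]
    generalize ((τ : ℂ) ^ 2 * E₄ τ).re = x at h4 ⊢
    generalize ((τ : ℂ) ^ 3 * E₆ τ).re = y at h6 ⊢
    have : ((3 : ℕ) : ℂ) * I * ((τ : ℂ) ^ 3 * E₆ τ) -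
        2 * pi * ((τ : ℂ) ^ (3 + 1) * ((E2 τ * E₆ τ - E₄ τ ^ 2) / 2)) =
        (3 * I - pi * (τ * E2 τ)) * (y : ℂ) + ((pi * x ^ 2 : ℝ) : ℂ) := by
      push_cast
      rw [← h4, ← h6]
      ring
    rw [this, Complex.add_re, Complex.re_mul_ofReal, Complex.ofReal_re]
  · intro t ht
    obtain ⟨τ, hτt, hτ⟩ := hrange ht
    convert! HasDerivAt.complex_re (hasDerivAt_arcFun (n := 6) hτt (hasDerivAt_discriminant τ))
      using 1
    have h6 := hC hτ
    simp only [c, arcFun_eq hτt, ← hτt, ofComplex_apply]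
    generalize ((τ : ℂ) ^ 6 * discriminant τ).re = y at h6 ⊢
    have : ((6 : ℕ) : ℂ) * I * ((τ : ℂ) ^ 6 * discriminant τ) -
        2 * pi * ((τ : ℂ) ^ (6 + 1) * (E2 τ * discriminant τ)) =
        (3 * I - pi * (τ * E2 τ)) * ((2 * y : ℝ) : ℂ) := by
      push_cast
      rw [← h6]
      ring
    rw [this, Complex.re_mul_ofReal]
    ring
  · intro t ht h0
    obtain ⟨τ, hτt, hτ⟩ := hrange ht
    have h6 := hC hτ
    rw [arcFun_eq hτt] at h0
    rw [h0, Complex.ofReal_zero] at h6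
    exact mul_ne_zero (pow_ne_zero _ τ.ne_zero) (discriminant_ne_zero τ) h6
  · obtain ⟨τ, hτt, hτ⟩ := hrange (t := pi / 2) ⟨le_rfl, by linarith⟩
    have hI : (τ : ℂ) = I := by
      rw [hτt]; push_cast; exact Complex.exp_pi_div_two_mul_I
    rw [arcFun_eq hτt, E₆_eq_zero (by rw [hI, Complex.I_sq])]
    simp
  -- At the endpoint ρ, E₄ and hence j vanish; at the other endpoint i, b is 0. By monotonicity j -
  -- 1728 stays in [-1728, 0].
  have hend : (arcFun 3 E₆ (2 * pi / 3)).re ^ 2 / (arcFun 6 discriminant (2 * pi / 3)).re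
      = -1728 := by
    obtain ⟨τ, hτt, hτ⟩ := hrange (t := 2 * pi / 3) ⟨by linarith, le_rfl⟩
    have hρ : (τ : ℂ) ^ 2 + τ + 1 = 0 := by
      have h3 : (τ : ℂ) ^ 3 = 1 := by
        rw [hτt, ← Complex.exp_nat_mul, ← Complex.exp_two_pi_mul_I]
        congr 1
        push_cast
        ring
      have hne : (τ : ℂ) - 1 ≠ 0 := by
        intro h
        have h1 : (τ : ℂ).im = 0 := by
          rw [sub_eq_zero.mp h]; simp
        exact τ.im_pos.ne' h1
      refine (mul_eq_zero.mp (?_ : ((τ : ℂ) - 1) * _ = 0)).resolve_left hne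
      linear_combination h3
    have h := hu hτt hτ
    rw [jInv, E₄_eq_zero hρ] at h
    refine (Complex.ofReal_injective (Eq.trans ?_ h)).symm
    simp
  rw [hend] at key
  have hre : -1 ≤ τ.re := by linarith
  have hτt : (τ : ℂ) = Complex.exp ((Real.arccos τ.re : ℝ) * I) := by
    have hns : τ.re ^ 2 + τ.im ^ 2 = 1 := by
      have := Complex.sq_norm (τ : ℂ)
      rw [hτ, Complex.normSq_apply] at this
      simp only [coe_re, coe_im] at this
      linarith
    apply Complex.ext
    · rw [Complex.exp_ofReal_mul_I_re, Real.cos_arccos hre (by linarith)]; rfl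
    · rw [Complex.exp_ofReal_mul_I_im, Real.sin_arccos, ← hns, add_sub_cancel_left,
        Real.sqrt_sq τ.im_pos.le]; rfl
  have hmem : Real.arccos τ.re ∈ Set.Icc (pi / 2) (2 * pi / 3) := by
    constructor
    · rw [← Real.arccos_zero]
      exact Real.arccos_le_arccos h2
    · have hc : Real.cos (2 * pi / 3) = -(1 / 2) := by
        rw [show 2 * pi / 3 = pi - pi / 3 by ring, Real.cos_pi_sub, Real.cos_pi_div_three]
      rw [← Real.arccos_cos (x := 2 * pi / 3) (by linarith) (by linarith), hc]
      exact Real.arccos_le_arccos h1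
  have hk := key hmem
  have hj := hu hτt hτ
  rw [Set.uIcc_of_ge (by norm_num)] at hk
  refine ⟨_ + 1728, ⟨?_, ?_⟩, by rw [Complex.ofReal_add, ← hj]; push_cast; ring⟩
  · linarith [hk.1]
  · linarith [hk.2]

/-- Every orbit of `SL(2, ℤ)` meets the fundamental domain. -/
lemma exists_smul_mem_fundamentalDomain (τ : ℍ) : ∃ γ : SL(2, ℤ), γ • τ ∈ fundamentalDomain := by
  obtain ⟨γ, hγ⟩ := ModularGroup.exists_smul_mem_fd τ
  obtain ⟨hn, hr⟩ := hγ
  generalize hσ : γ • τ = σ at hn hr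
  have hn' : 1 ≤ ‖(σ : ℂ)‖ := by
    rw [Complex.normSq_eq_norm_sq] at hn
    nlinarith [norm_nonneg (σ : ℂ)]
  rw [abs_le] at hr
  rcases le_or_gt σ.re 0 with h0 | h0
  · exact ⟨γ, by rw [hσ]; exact Or.inl ⟨hn', by linarith, h0⟩⟩
  -- The right half of the boundary is moved to the left half, by `S` on the arc and by `T⁻¹` on Re
  -- = 1/2; both act there as σ ↦ -conj σ.
  rcases hr.2.lt_or_eq with hlt | heq
  · rcases hn'.lt_or_eq with hgt | h1
    · exact ⟨γ, by rw [hσ]; exact Or.inr ⟨hgt, h0, by linarith⟩⟩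
    · refine ⟨ModularGroup.S * γ, ?_⟩
      rw [mul_smul, hσ, S_smul_eq_J_smul h1.symm]
      have hre : (J • σ).re = -σ.re := by
        rw [← coe_re, coe_J_smul]; simp
      refine Or.inl ⟨?_, ?_, ?_⟩
      · rw [coe_J_smul, norm_neg, Complex.norm_conj]; exact hn'
      · rw [hre]; linarith
      · rw [hre]; linarith
  · refine ⟨ModularGroup.T⁻¹ * γ, ?_⟩
    rw [mul_smul, hσ]
    have hc : ((ModularGroup.T⁻¹ • σ : ℍ) : ℂ) = -conj (σ : ℂ) := by
      have hT := ModularGroup.coe_T_zpow_smul_eq (z := σ) (n := -1)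
      rw [zpow_neg_one] at hT
      rw [hT]
      apply Complex.ext
      · simp; linarith
      · simp
    have hre : (ModularGroup.T⁻¹ • σ).re = -σ.re := by
      rw [← coe_re, hc]; simp
    refine Or.inl ⟨?_, ?_, ?_⟩
    · rw [hc, norm_neg, Complex.norm_conj]; exact hn'
    · rw [hre]; linarith
    · rw [hre]; linarith

/-! ### The associated polynomial: existence, uniqueness, reality. -/

open Polynomial (C X)

lemma exists_weight_eq {k : ℤ} (hk : Even k) :
    ∃ (ε δ : ℕ) (m : ℤ), ε ≤ 2 ∧ δ ≤ 1 ∧ k = 4 * ε + 6 * δ + 12 * m := by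
  obtain ⟨l, rfl⟩ := hk
  have h : l % 6 = 0 ∨ l % 6 = 1 ∨ l % 6 = 2 ∨ l % 6 = 3 ∨ l % 6 = 4 ∨ l % 6 = 5 := by omega
  rcases h with h | h | h | h | h | h
  · exact ⟨0, 0, l / 6, by omega, by omega, by omega⟩
  · exact ⟨2, 1, l / 6 - 1, by omega, by omega, by omega⟩
  · exact ⟨1, 0, l / 6, by omega, by omega, by omega⟩
  · exact ⟨0, 1, l / 6, by omega, by omega, by omega⟩
  · exact ⟨2, 0, l / 6, by omega, by omega, by omega⟩
  · exact ⟨1, 1, l / 6, by omega, by omega, by omega⟩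

lemma weight_unique {k m m' : ℤ} {ε ε' δ δ' : ℕ} (hε : ε ≤ 2) (hδ : δ ≤ 1)
    (h : k = 4 * ε + 6 * δ + 12 * m) (hε' : ε' ≤ 2) (hδ' : δ' ≤ 1)
    (h' : k = 4 * ε' + 6 * δ' + 12 * m') : ε = ε' ∧ δ = δ' ∧ m = m' := by
  omega

lemma isAssociatedPolynomial_zero {k : ℤ} (hk : Even k) {g : ℍ → ℂ} (hg : ∀ τ, g τ = 0) :
    IsAssociatedPolynomial k g 0 := by
  obtain ⟨ε, δ, m, h1, h2, h3⟩ := exists_weight_eq hk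
  exact ⟨ε, δ, m, h1, h2, h3, fun τ ↦ by simp [hg]⟩

lemma exists_eq_discriminant_mul {k : ℤ} (g : ModularForm 𝒮ℒ k)
    (h0 : (qExpansion 1 g).coeff 0 = 0) :
    ∃ q : ModularForm 𝒮ℒ (k - 12), ∀ τ, g τ = discriminant τ * q τ :=
  ⟨CuspForm.discriminantEquiv (toCuspForm g h0), fun τ ↦
    ((discriminant_mul_discriminantEquiv_apply (toCuspForm g h0) τ).trans
      (toCuspForm_apply g h0 τ)).symm⟩

/-- Every modular form of level one is `E₄ ^ ε * E₆ ^ δ * Δ ^ m` times a polynomial in `j`. -/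
lemma exists_isAssociatedPolynomial_modularForm (n : ℕ) : ∀ (k : ℤ), k < n → Even k →
    ∀ g : ModularForm 𝒮ℒ k, ∃ P, IsAssociatedPolynomial k g P := by
  induction n with
  | zero =>
    intro k hk he g
    have h0 : ⇑g = 0 := ModularFormClass.levelOne_neg_weight_eq_zero (by simpa using hk) g
    exact ⟨0, isAssociatedPolynomial_zero he fun τ ↦ by rw [h0]; rfl⟩
  | succ n ih =>
    intro k hk he g
    rcases lt_or_ge k n with hlt | hge
    · exact ih k hlt he g
    obtain ⟨ε, δ, m, h1, h2, h3⟩ := exists_weight_eq he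
    -- With k ≥ 0, a negative m occurs only for 2 = 4 · 2 + 6 · 1 - 12.
    rcases lt_or_ge m 0 with hm | hm
    · obtain rfl : k = 2 := by omega
      have h0 := rank_zero_iff_forall_zero.mp levelOne_weight_two_rank_zero g
      exact ⟨0, isAssociatedPolynomial_zero he fun τ ↦ by rw [h0]; rfl⟩
    lift m to ℕ using hm
    -- h = E₄^ε E₆^δ Δ^m j^m has value 1 at i∞. Subtracting c h leaves a cusp form, which is Δ times
    -- a form of weight k - 12; h accounts for the term c X^m.
    let h : ModularForm 𝒮ℒ k := ModularForm.mcast (by push_cast; omega)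
      ((E₄.pow (ε + 3 * m)).mul (E₆.pow δ))
    have hh (τ : ℍ) : h τ = E₄ τ ^ (ε + 3 * m) * E₆ τ ^ δ := by
      simp only [h, coe_mcast, coe_mul, coe_pow, Pi.mul_apply, Pi.pow_apply]
    have hlim : Tendsto h atImInfty (𝓝 1) := by
      have := (tendsto_E₄.pow (ε + 3 * m)).mul (tendsto_E₆.pow δ)
      simp only [one_pow, mul_one] at this
      exact this.congr fun τ ↦ (hh τ).symm
    let c := (qExpansion 1 g).coeff 0
    let g' : ModularForm 𝒮ℒ k := g - c • h
    have hg' (τ : ℍ) : g' τ = g τ - c * h τ := rfl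
    have hc0 : (qExpansion 1 g').coeff 0 = 0 := by
      have hl := (tendsto_valueAtInfty g).sub (hlim.const_mul c)
      rw [mul_one, sub_self] at hl
      exact tendsto_nhds_unique (tendsto_valueAtInfty g') (hl.congr fun τ ↦ (hg' τ).symm)
    obtain ⟨q, hq⟩ := exists_eq_discriminant_mul g' hc0
    obtain ⟨Q, ε', δ', m', h1', h2', h3', hQ⟩ := ih (k - 12) (by push_cast at hk; omega)
      (he.sub (by decide)) q
    obtain ⟨rfl, rfl, hm'⟩ := weight_unique (k := k) h1 h2 h3 h1' h2' (m' := m' + 1) (by omega)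
    refine ⟨C c * X ^ m + Q, ε, δ, m, h1, h2, h3, fun τ ↦ ?_⟩
    have hτ := hq τ
    have hΔ := discriminant_ne_zero τ
    rw [hg', hh, hQ, pow_add, pow_mul, E₄_pow_three, mul_pow,
      show m' = (m : ℤ) - 1 by omega, zpow_sub_one₀ hΔ, zpow_natCast] at hτ
    rw [zpow_natCast]
    simp only [Polynomial.eval_add, Polynomial.eval_mul, Polynomial.eval_C, Polynomial.eval_pow,
      Polynomial.eval_X]
    field_simp at hτ
    linear_combination hτ

/-- The series converges absolutely at i. Raising Im τ from 1 multiplies the norm of each term with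
n ≥ N by at most exp(-2πN(Im τ - 1)). -/
lemma HasFourierExpansion.exists_norm_le {f : ℍ → ℂ} {a : ℤ → ℂ} {N : ℤ} (ha : ∀ n < N, a n = 0)
    (hf : HasFourierExpansion f a) :
    ∃ B : ℝ, ∀ τ : ℍ, 1 ≤ τ.im → ‖f τ‖ ≤ B * Real.exp (-2 * pi * N * τ.im) := by
  have hn (n : ℤ) (τ : ℍ) : ‖a n * Complex.exp (2 * pi * I * n * (τ : ℂ))‖ =
      ‖a n‖ * Real.exp (-2 * pi * n * τ.im) := by
    rw [norm_mul, Complex.norm_exp]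
    congr 2
    simp
  have hsum := (hf UpperHalfPlane.I).summable.norm
  simp only [hn, UpperHalfPlane.I_im, mul_one] at hsum
  refine ⟨Real.exp (2 * pi * N) * ∑' n, ‖a n‖ * Real.exp (-2 * pi * n), fun τ hτ ↦ ?_⟩
  have hle (n : ℤ) : ‖a n * Complex.exp (2 * pi * I * n * (τ : ℂ))‖ ≤
      Real.exp (2 * pi * N) * Real.exp (-2 * pi * N * τ.im) *
        (‖a n‖ * Real.exp (-2 * pi * n)) := by
    rw [hn]
    rcases lt_or_ge n N with h | h
    · simp [ha n h]
    · rw [mul_left_comm, ← Real.exp_add, ← Real.exp_add]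
      gcongr
      have h' : (N : ℝ) ≤ n := mod_cast h
      have := mul_nonneg Real.pi_pos.le (mul_nonneg (sub_nonneg.mpr h') (sub_nonneg.mpr hτ))
      linarith
  have h := (hf τ).norm_le_of_bounded (hsum.mul_left _).hasSum hle
  rw [tsum_mul_left] at h
  linarith

/-- Multiplying by Δ^N with N ≥ -n₀ removes the pole at i∞; dividing back only shifts m. -/
lemma IsWeaklyHolomorphic.exists_isAssociatedPolynomial {k : ℤ} (hk : Even k) {f : ℍ → ℂ}
    (hf : IsWeaklyHolomorphic k f) : ∃ P, IsAssociatedPolynomial k f P := by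
  obtain ⟨n₀, a, ha, hfa⟩ := hf.fourier
  obtain ⟨B, hB⟩ := hfa.exists_norm_le ha
  let N : ℕ := (-n₀).toNat
  have hbdd : IsBoundedAtImInfty (fun τ ↦ f τ * discriminant τ ^ N) := by
    have hΔ := (CuspFormClass.exp_decay_atImInfty (h := 1) CuspForm.discriminant one_pos
      one_mem_strictPeriods_SL).pow N
    have hf' : f =O[atImInfty] fun τ : ℍ ↦ Real.exp (-2 * pi * n₀ * τ.im) := by
      refine .of_bound B ?_
      have : ∀ᶠ τ : ℍ in atImInfty, 1 ≤ τ.im := tendsto_comap.eventually (eventually_ge_atTop 1)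
      filter_upwards [this] with τ hτ
      rw [Real.norm_of_nonneg (Real.exp_pos _).le]
      exact hB τ hτ
    refine (hf'.mul hΔ).trans (.of_bound 1 (Eventually.of_forall fun τ ↦ ?_))
    rw [← Real.exp_nat_mul, ← Real.exp_add, Real.norm_of_nonneg (Real.exp_pos _).le]
    simp only [Pi.one_apply, norm_one, mul_one, Real.exp_le_one_iff]
    have hN : (0 : ℝ) ≤ n₀ + N := by
      have : 0 ≤ n₀ + N := by omega
      exact_mod_cast this
    have := mul_nonneg Real.pi_pos.le (mul_nonneg hN τ.im_pos.le)
    linarith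
  let g : ModularForm 𝒮ℒ (k + 12 * N) := modularFormOfInvariant
    (fun τ ↦ f τ * discriminant τ ^ N)
    (hf.holo.mul (mdifferentiable_discriminant.pow N))
    (fun γ ↦ by
      ext τ
      have hd := denom_ne_zero γ τ
      rw [SL_slash_apply, hf.transform, discriminant_smul, mul_pow, ← pow_mul, zpow_neg,
        zpow_add₀ hd]
      have : denom γ τ ^ (12 * N : ℤ) = denom γ τ ^ (12 * N) := mod_cast zpow_natCast _ (12 * N)
      rw [this]
      have := zpow_ne_zero k hd
      field_simp)
    hbdd
  obtain ⟨P, ε, δ, m, h1, h2, h3, hP⟩ := exists_isAssociatedPolynomial_modularForm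
    (k + 12 * N + 1).toNat (k + 12 * N) (by omega)
    (hk.add (by rw [Int.even_mul]; left; decide)) g
  refine ⟨P, ε, δ, m - N, h1, h2, by omega, fun τ ↦ ?_⟩
  have hΔ := discriminant_ne_zero τ
  have := hP τ
  simp only [g, modularFormOfInvariant_apply] at this
  rw [zpow_sub₀ hΔ, zpow_natCast]
  field_simp
  linear_combination this

/-- Since j is onto and E₄, E₆ vanish only where j is 0 or 1728, both polynomials agree at all other
points. -/
lemma isAssociatedPolynomial_unique {k : ℤ} {g : ℍ → ℂ} {P Q : Polynomial ℂ}
    (hP : IsAssociatedPolynomial k g P) (hQ : IsAssociatedPolynomial k g Q) : P = Q := by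
  obtain ⟨ε, δ, m, h1, h2, h3, hP⟩ := hP
  obtain ⟨ε', δ', m', h1', h2', h3', hQ⟩ := hQ
  obtain ⟨rfl, rfl, rfl⟩ := weight_unique h1 h2 h3 h1' h2' h3'
  refine Polynomial.eq_of_infinite_eval_eq P Q
    ((Set.Finite.infinite_compl (s := {(0 : ℂ), 1728}) (by simp)).mono fun z hz ↦ ?_)
  obtain ⟨τ, rfl⟩ := jInv_surjective z
  simp only [Set.mem_compl_iff, Set.mem_insert_iff, Set.mem_singleton_iff, not_or] at hz
  have hΔ := discriminant_ne_zero τ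
  have h4 : E₄ τ ≠ 0 := by
    intro h
    exact hz.1 (by simp [jInv, h])
  have h6 : E₆ τ ≠ 0 := by
    intro h
    have := E₆_pow_two τ
    rw [h, zero_pow two_ne_zero, zero_eq_mul] at this
    exact hz.2 (sub_eq_zero.mp (this.resolve_right hΔ))
  exact mul_left_cancel₀ (mul_ne_zero (mul_ne_zero (pow_ne_zero _ h4) (pow_ne_zero _ h6))
    (zpow_ne_zero _ hΔ)) ((hP τ).symm.trans (hQ τ))

/-- The polynomial of a function with real Fourier coefficients is real. -/
lemma exists_real_of_isAssociatedPolynomial {k : ℤ} {g : ℍ → ℂ} {P : Polynomial ℂ}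
    (hP : IsAssociatedPolynomial k g P) (hg : ∀ τ, g (J • τ) = conj (g τ)) :
    ∃ R : Polynomial ℝ, P = R.map (algebraMap ℝ ℂ) := by
  -- By the reflection symmetry, conjugating the coefficients gives another polynomial associated
  -- with g.
  have hconj : P.map (starRingEnd ℂ) = P := by
    refine isAssociatedPolynomial_unique ?_ hP
    obtain ⟨ε, δ, m, h1, h2, h3, hP⟩ := hP
    refine ⟨ε, δ, m, h1, h2, h3, fun τ ↦ ?_⟩
    have h := congrArg conj (hP (J • τ))
    rw [hg, Complex.conj_conj, E₄_J_smul, E₆_J_smul, discriminant_J_smul, jInv_J_smul] at h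
    simpa [Polynomial.eval_map, Polynomial.hom_eval₂, Polynomial.eval₂_at_apply,
      ← Polynomial.eval₂_hom] using h
  have : P ∈ Polynomial.lifts (algebraMap ℝ ℂ) := by
    rw [Polynomial.lifts_iff_coeff_lifts]
    intro n
    have h := congrArg (Polynomial.coeff · n) hconj
    simp only [Polynomial.coeff_map] at h
    exact ⟨(P.coeff n).re, Complex.conj_eq_iff_re.mp h⟩
  obtain ⟨R, hR⟩ := Polynomial.mem_lifts _ |>.mp this
  exact ⟨R, hR.symm⟩

/-! ### The polynomial of the Serre derivative. -/

lemma serreDerivative_eq_of_hasDerivAt {k : ℂ} {f : ℍ → ℂ} {τ : ℍ} {d : ℂ}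
    (h : HasDerivAt (f ∘ ofComplex) (2 * pi * I * (d + k / 12 * E2 τ * f τ)) (τ : ℂ)) :
    serreDerivative k f τ = d := by
  rw [serreDerivative_apply, normalizedDerivOfComplex, h.deriv,
    inv_mul_cancel_left₀ Complex.two_pi_I_ne_zero]
  ring

/-- The numerator of `P' / P + α / X + β / (X - 1728)`. -/
def logDerivNum (α β : ℝ) (P : Polynomial ℝ) : Polynomial ℝ :=
  C α * (X - C 1728) * P + C β * X * P + X * (X - C 1728) * P.derivative

/-- Only divisibility is claimed: the numerator has a superfluous factor X when ε = 0 and X - 1728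
when δ = 0. -/
lemma exists_isAssociatedPolynomial_serreDerivative {k m : ℤ} {ε δ : ℕ} (hε : ε ≤ 2) (hδ : δ ≤ 1)
    (hk : k = 4 * ε + 6 * δ + 12 * m) {f : ℍ → ℂ} {P : Polynomial ℝ}
    (hf : ∀ τ : ℍ, f τ = E₄ τ ^ ε * E₆ τ ^ δ * discriminant τ ^ m *
      (P.map (algebraMap ℝ ℂ)).eval (jInv τ)) :
    ∃ Q : Polynomial ℝ, Q ∣ logDerivNum (ε / 3) (δ / 2) P ∧
      IsAssociatedPolynomial (k + 2) (serreDerivative k f) (Q.map (algebraMap ℝ ℂ)) := by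
  have hd (τ : ℍ) := (((hasDerivAt_E₄ τ).pow ε).mul ((hasDerivAt_E₆ τ).pow δ)).mul
    ((hasDerivAt_zpow m (discriminant τ) (Or.inl (discriminant_ne_zero τ))).comp_of_eq (τ : ℂ)
      (hasDerivAt_discriminant τ) (by simp)) |>.mul
    (((P.map (algebraMap ℝ ℂ)).hasDerivAt (jInv τ)).comp_of_eq (τ : ℂ)
      (hasDerivAt_jInv τ) (by simp))
  have hfun : f ∘ ofComplex = ((E₄ ∘ ofComplex) ^ ε * (E₆ ∘ ofComplex) ^ δ *
      (fun x ↦ x ^ m) ∘ (discriminant ∘ ofComplex) : ℂ → ℂ) *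
      (fun x ↦ (P.map (algebraMap ℝ ℂ)).eval x) ∘ (jInv ∘ ofComplex) := by
    ext w
    simp [hf]
  simp only [← hfun, Pi.mul_apply, Pi.pow_apply, comp_apply, ofComplex_apply] at hd
  have hkC : (k : ℂ) = 4 * ε + 6 * δ + 12 * m := by rw [hk]; push_cast; ring
  have key (ε' δ' : ℕ) (m' : ℤ) (h1 : ε' ≤ 2) (h2 : δ' ≤ 1)
      (h3 : k + 2 = 4 * ε' + 6 * δ' + 12 * m') (Q T : Polynomial ℝ)
      (hT : logDerivNum (ε / 3) (δ / 2) P = Q * T)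
      (hQ : ∀ τ : ℍ, HasDerivAt (f ∘ ofComplex) (2 * pi * I *
        (E₄ τ ^ ε' * E₆ τ ^ δ' * discriminant τ ^ m' * (Q.map (algebraMap ℝ ℂ)).eval (jInv τ) +
        k / 12 * E2 τ * f τ)) (τ : ℂ)) :
      ∃ Q : Polynomial ℝ, Q ∣ logDerivNum (ε / 3) (δ / 2) P ∧
      IsAssociatedPolynomial (k + 2) (serreDerivative k f) (Q.map (algebraMap ℝ ℂ)) :=
    ⟨Q, ⟨T, hT⟩, ε', δ', m', h1, h2, h3, fun τ ↦ serreDerivative_eq_of_hasDerivAt (hQ τ)⟩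
  have hj (τ : ℍ) : jInv τ = E₄ τ ^ 3 / discriminant τ := rfl
  have hj' (τ : ℍ) : jInv τ - 1728 = E₆ τ ^ 2 / discriminant τ := by
    rw [E₆_pow_two, mul_div_cancel_right₀ _ (discriminant_ne_zero τ)]
  clear hfun
  -- The new exponents come from multiplying by E₄²E₆/Δ and trading E₄³ for jΔ and E₆² for (j -
  -- 1728)Δ.
  have hcase : (ε = 0 ∨ ε = 1 ∨ ε = 2) ∧ (δ = 0 ∨ δ = 1) := by omega
  obtain ⟨rfl | rfl | rfl, rfl | rfl⟩ := hcase
  · refine key 2 1 (m - 1) le_rfl le_rfl (by push_cast at *; omega) (-P.derivative)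
      (-(X * (X - C 1728))) (by simp [logDerivNum]; ring) fun τ ↦ ?_
    convert! hd τ using 1
    rw [hf, hkC]
    have hΔ := discriminant_ne_zero τ
    simp only [Polynomial.map_neg, Polynomial.eval_neg, zpow_sub_one₀ hΔ, Polynomial.derivative_map]
    field_simp
    push_cast
    ring
  · refine key 2 0 m le_rfl (by norm_num) (by push_cast at *; omega)
      (-(C (1 / 2) * P + (X - C 1728) * P.derivative)) (-X) (by simp [logDerivNum]; ring)
      fun τ ↦ ?_
    convert! hd τ using 1
    rw [hf, hkC]
    have hΔ := discriminant_ne_zero τ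
    simp [Polynomial.derivative_map, zpow_sub_one₀ hΔ, hj', -mul_eq_mul_left_iff]
    field_simp
    ring
  · refine key 0 1 m (by norm_num) (by norm_num) (by push_cast at *; omega)
      (-(C (1 / 3) * P + X * P.derivative)) (-(X - C 1728))
      (by simp [logDerivNum]; ring) fun τ ↦ ?_
    convert! hd τ using 1
    rw [hf, hkC]
    have hΔ := discriminant_ne_zero τ
    simp [Polynomial.derivative_map, zpow_sub_one₀ hΔ, -mul_eq_mul_left_iff]
    rw [hj]
    field_simp
    ring
  · refine key 0 0 (m + 1) (by norm_num) (by norm_num) (by push_cast at *; omega)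
      (-(C (1 / 3) * (X - C 1728) * P + C (1 / 2) * X * P +
        X * (X - C 1728) * P.derivative)) (-1)
      (by simp [logDerivNum]) fun τ ↦ ?_
    convert! hd τ using 1
    rw [hf, hkC]
    have hΔ := discriminant_ne_zero τ
    simp [Polynomial.derivative_map, zpow_sub_one₀ hΔ, zpow_add_one₀ hΔ, hj', -mul_eq_mul_left_iff]
    rw [hj]
    field_simp
    ring
  · refine key 1 1 m (by norm_num) (by norm_num) (by push_cast at *; omega)
      (-(C (2 / 3) * P + X * P.derivative)) (-(X - C 1728))
      (by simp [logDerivNum]; ring) fun τ ↦ ?_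
    convert! hd τ using 1
    rw [hf, hkC]
    have hΔ := discriminant_ne_zero τ
    simp [Polynomial.derivative_map, zpow_sub_one₀ hΔ, -mul_eq_mul_left_iff]
    rw [hj]
    field_simp
    ring
  · refine key 1 0 (m + 1) (by norm_num) (by norm_num) (by push_cast at *; omega)
      (-(C (2 / 3) * (X - C 1728) * P + C (1 / 2) * X * P +
        X * (X - C 1728) * P.derivative)) (-1)
      (by simp [logDerivNum]) fun τ ↦ ?_
    convert! hd τ using 1
    rw [hf, hkC]
    have hΔ := discriminant_ne_zero τ
    simp [Polynomial.derivative_map, zpow_sub_one₀ hΔ, zpow_add_one₀ hΔ, hj', -mul_eq_mul_left_iff]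
    rw [hj]
    field_simp
    ring

/-! ### The Gauss–Lucas argument and the conclusion. -/

/-- Seen from z off the segment, all (z - x)⁻¹ lie in one open half-plane: Im (z - x)⁻¹ has the sign
of -Im z, and for real z the sign of z - x is constant. -/
lemma exists_functional_pos {z : ℂ} {a b : ℝ} (hz : ∀ x ∈ Set.Icc a b, z ≠ (x : ℂ)) :
    ∃ φ : ℂ →ₗ[ℝ] ℝ, ∀ x ∈ Set.Icc a b, 0 < φ (z - x)⁻¹ := by
  have hpos : ∀ x ∈ Set.Icc a b, 0 < Complex.normSq (z - x) := fun x hx ↦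
    Complex.normSq_pos.mpr (sub_ne_zero.mpr (hz x hx))
  by_cases him : z.im = 0
  · have hz' : z = (z.re : ℂ) := Complex.ext rfl (by simp [him])
    by_cases hl : z.re < a
    · refine ⟨-Complex.reLm, fun x hx ↦ ?_⟩
      simp only [LinearMap.neg_apply, Complex.reLm_coe, Complex.inv_re, Complex.sub_re,
        Complex.ofReal_re]
      rw [← neg_div]
      exact div_pos (by linarith [hx.1]) (hpos x hx)
    · refine ⟨Complex.reLm, fun x hx ↦ ?_⟩
      simp only [Complex.reLm_coe, Complex.inv_re, Complex.sub_re, Complex.ofReal_re]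
      refine div_pos ?_ (hpos x hx)
      by_contra! h
      exact hz z.re ⟨not_lt.mp hl, by linarith [hx.2]⟩ hz'
  · refine ⟨-z.im • Complex.imLm, fun x hx ↦ ?_⟩
    simp only [LinearMap.smul_apply, Complex.imLm_coe, Complex.inv_im, Complex.sub_im,
      Complex.ofReal_im, sub_zero, smul_eq_mul]
    rw [mul_div_assoc', neg_mul_neg]
    exact div_pos (mul_self_pos.mpr him) (hpos x hx)

/-- A variant of the Gauss–Lucas theorem. -/
lemma isRoot_logDerivNum {α β : ℝ} {P : Polynomial ℝ} (hα : 0 ≤ α) (hβ : 0 ≤ β) (hP : P ≠ 0)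
    (hroots : ∀ z : ℂ, (P.map (algebraMap ℝ ℂ)).IsRoot z → ∃ x ∈ Set.Icc (0 : ℝ) 1728, z = (x : ℂ))
    (hne : α ≠ 0 ∨ β ≠ 0 ∨ P.natDegree ≠ 0) {z : ℂ}
    (hz : ((logDerivNum α β P).map (algebraMap ℝ ℂ)).IsRoot z) :
    ∃ x ∈ Set.Icc (0 : ℝ) 1728, z = (x : ℂ) := by
  by_contra! hcon
  set p := P.map (algebraMap ℝ ℂ) with hp
  have hpz : p.eval z ≠ 0 := fun h ↦ by
    obtain ⟨x, hx, h⟩ := hroots z h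
    exact hcon x hx h
  obtain ⟨φ, hφ⟩ := exists_functional_pos hcon
  have h0 : z ≠ 0 := by simpa using hcon 0 (by norm_num)
  have h1728 : z - 1728 ≠ 0 := sub_ne_zero.mpr (by simpa using hcon 1728 (by norm_num))
  have hsum : (p.derivative.eval z) / p.eval z = (p.roots.map fun r ↦ (z - r)⁻¹).sum := by
    simpa using (IsAlgClosed.splits p).eval_derivative_div_eval_of_ne_zero hpz
  -- Dividing by z(z - 1728)P(z) turns the root into a vanishing sum; φ is positive on every term
  -- with positive weight, and `hne` provides one.
  have heq : (α : ℂ) * z⁻¹ + β * (z - 1728)⁻¹ + (p.roots.map fun r ↦ (z - r)⁻¹).sum = 0 := by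
    rw [← hsum]
    simp only [logDerivNum, Polynomial.IsRoot.def, Polynomial.map_add, Polynomial.map_mul,
      Polynomial.map_sub, Polynomial.map_C, Polynomial.map_X, ← Polynomial.derivative_map,
      ← hp, Polynomial.eval_add, Polynomial.eval_mul, Polynomial.eval_sub, Polynomial.eval_C,
      Polynomial.eval_X] at hz
    simp only [Complex.coe_algebraMap, Complex.ofReal_ofNat] at hz
    field_simp
    linear_combination hz
  have ha : 0 < φ z⁻¹ := by simpa using hφ 0 (by norm_num)
  have hb : 0 < φ (z - 1728)⁻¹ := by simpa using hφ 1728 (by norm_num)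
  have hr : ∀ r ∈ p.roots, 0 < φ (z - r)⁻¹ := fun r hr ↦ by
    obtain ⟨x, hx, rfl⟩ := hroots r (Polynomial.isRoot_of_mem_roots hr)
    exact hφ x hx
  have hφs := congrArg φ heq
  rw [map_add, map_add, ← Complex.real_smul, ← Complex.real_smul, map_smul, map_smul,
    map_multiset_sum, map_zero, Multiset.map_map, smul_eq_mul, smul_eq_mul] at hφs
  have hs0 : 0 ≤ (p.roots.map (φ ∘ fun r ↦ (z - r)⁻¹)).sum :=
    Multiset.sum_nonneg fun y hy ↦ by
      obtain ⟨r, hr', rfl⟩ := Multiset.mem_map.mp hy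
      exact (hr r hr').le
  have h1 := mul_nonneg hα ha.le
  have h2 := mul_nonneg hβ hb.le
  rcases hne with h | h | h
  · have := mul_pos (hα.lt_of_ne' h) ha
    linarith
  · have := mul_pos (hβ.lt_of_ne' h) hb
    linarith
  · have hdeg : p.degree ≠ 0 := by
      rw [hp, Polynomial.degree_map, Polynomial.degree_eq_natDegree hP]
      exact_mod_cast h
    obtain ⟨r, hr'⟩ := IsAlgClosed.exists_root p hdeg
    have hp0 : p ≠ 0 := by rintro h; exact hpz (by rw [h]; simp)
    obtain ⟨t, ht⟩ := Multiset.exists_cons_of_mem ((Polynomial.mem_roots hp0).mpr hr')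
    have hrp := hr r (by rw [ht]; exact Multiset.mem_cons_self _ _)
    have hst : 0 ≤ (t.map (φ ∘ fun r ↦ (z - r)⁻¹)).sum :=
      Multiset.sum_nonneg fun y hy ↦ by
        obtain ⟨r, hr', rfl⟩ := Multiset.mem_map.mp hy
        exact (hr r (by rw [ht]; exact Multiset.mem_cons_of_mem hr')).le
    rw [ht, Multiset.map_cons, Multiset.sum_cons] at hφs
    simp only [comp_apply] at hφs hst
    linarith

end SerreZeros

end

theorem theorem6p1 (k : ℤ) (hk : Even k) (f : ℍ → ℂ)
    (hf : SerreZeros.IsWeaklyHolomorphic k f) (hf0 : f ≠ 0)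
    (hreal : SerreZeros.HasRealFourierCoefficients f)
    (hzero : ∃ τ : ℍ, f τ = 0)
    (harc : ∀ τ ∈ SerreZeros.fundamentalDomain, f τ = 0 → τ ∈ SerreZeros.lowerArc) :
    ∃ P : Polynomial ℝ,
      SerreZeros.IsAssociatedPolynomial (k + 2) (Derivative.serreDerivative (k : ℂ) f)
        (P.map (algebraMap ℝ ℂ)) ∧
      (∀ Q : Polynomial ℂ,
        SerreZeros.IsAssociatedPolynomial (k + 2) (Derivative.serreDerivative (k : ℂ) f) Q →
          Q = P.map (algebraMap ℝ ℂ)) ∧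
      ∀ z : ℂ, (P.map (algebraMap ℝ ℂ)).IsRoot z → ∃ x ∈ Set.Icc (0 : ℝ) 1728, z = (x : ℂ) := by
  obtain ⟨P₀, hP₀⟩ := hf.exists_isAssociatedPolynomial hk
  obtain ⟨P, rfl⟩ := SerreZeros.exists_real_of_isAssociatedPolynomial hP₀ hreal.J_smul
  obtain ⟨ε, δ, m, hε, hδ, hkm, hfP⟩ := hP₀
  obtain ⟨Q, hQdvd, hQ⟩ :=
    SerreZeros.exists_isAssociatedPolynomial_serreDerivative hε hδ hkm hfP
  refine ⟨Q, hQ, fun Q' hQ' ↦ SerreZeros.isAssociatedPolynomial_unique hQ' hQ, fun z hz ↦ ?_⟩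
  have hP0 : P ≠ 0 := by
    rintro rfl
    exact hf0 (funext fun τ ↦ by simp [hfP])
  refine SerreZeros.isRoot_logDerivNum (P := P) (α := ε / 3) (β := δ / 2) (by positivity)
    (by positivity) hP0 (fun w hw ↦ ?_) ?_
    (hz.dvd (Polynomial.map_dvd (algebraMap ℝ ℂ) hQdvd))
  · obtain ⟨τ, rfl⟩ := SerreZeros.jInv_surjective w
    obtain ⟨γ, hγ⟩ := SerreZeros.exists_smul_mem_fundamentalDomain τ
    have hfγ : f (γ • τ) = 0 := by
      rw [hf.transform, hfP, hw.eq_zero, mul_zero, mul_zero]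
    obtain ⟨-, h1, h2, h3⟩ := harc _ hγ hfγ
    rw [← SerreZeros.jInv_smul γ τ]
    exact SerreZeros.jInv_mem_Icc_of_mem_arc h1 h2 h3
  -- Otherwise f = c Δ^m with c ≠ 0, which has no zero in ℍ.
  · by_contra! hcon
    obtain ⟨hε0, hδ0, hdeg⟩ := hcon
    obtain rfl : ε = 0 := by simpa using hε0
    obtain rfl : δ = 0 := by simpa using hδ0
    obtain ⟨c, rfl⟩ := Polynomial.natDegree_eq_zero.mp hdeg
    obtain ⟨τ, hτ⟩ := hzero
    rw [hfP] at hτ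
    have hc : c ≠ 0 := by rintro rfl; simp at hP0
    have := zpow_ne_zero m (ModularForm.discriminant_ne_zero τ)
    simp [hc, this] at hτ
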